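/- Lemma (Poincaré inequality II). For every integer $n \ge 2$ there is a constant $C = C(n) > 0$, depending only on $n$, with the following property. Let $\Omega \subset \mathbb{R}^n$ be a bounded open set that is star shaped with respect to an open ball $B$ of positive radius, that is, $B \subset \Omega$ and for every $y \in \Omega$ the convex hull of $B \cup \{y\}$ is contained in $\Omega$. Then there is a constant $K \ge 0$ such that every real valued $u \in H^1(\Omega)$ with $\int_\Omega u \, dx = 0$ satisfies \[ \|u\|_{L^2(\Omega)} \le K \operatorname{diam}(\Omega)\, |u|_{H^1(\Omega)}, \qquad |u|_{H^1(\Omega)} = \Big( \sum_{i=1}^n \|\partial_i u\|_{L^2(\Omega)}^2 \Big)^{1/2}, \] where $\partial_i u$ are the weak partial derivatives, and \[ K \le C \, \frac{R}{\rho} \left[ 1 + \left( \log \frac{|\Omega|}{|B|} \right)^{\frac{n}{2(n-1)}} \left( \frac{|\Omega|}{|B|} \right)^{\frac{n-2}{2(n-1)}} \right], \] where $R = \operatorname{diam}(\Omega)$, $\rho = \operatorname{diam}(B)$ and $|\cdot|$ denotes Lebesgue measure. -/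

import Mathlib

open MeasureTheory Set
open scoped ContDiff

noncomputable section

/-- `Ω` is star shaped with respect to the set `B` (in the theorem, a ball): `B ⊆ Ω` and, for every
`y ∈ Ω`, the convex hull of `B ∪ {y}` is contained in `Ω`. -/
def IsStarShapedWrt {n : ℕ} (Ω B : Set (EuclideanSpace ℝ (Fin n))) : Prop :=
  B ⊆ Ω ∧ ∀ y ∈ Ω, convexHull ℝ (B ∪ {y}) ⊆ Ω

/-- The norm of `L²(Ω)`, with respect to Lebesgue measure. -/
def l2Norm {n : ℕ} (Ω : Set (EuclideanSpace ℝ (Fin n))) (u : EuclideanSpace ℝ (Fin n) → ℝ) : ℝ :=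
  (eLpNorm u 2 (volume.restrict Ω)).toReal

/-- `g ∈ L²(Ω)` is the weak partial derivative `∂ᵢ u` on the open set `Ω`:
`∫_Ω u ∂ᵢφ = - ∫_Ω g φ` for all test functions `φ ∈ C_c^∞(Ω)`. -/
def IsWeakPartial {n : ℕ} (Ω : Set (EuclideanSpace ℝ (Fin n))) (i : Fin n)
    (u g : EuclideanSpace ℝ (Fin n) → ℝ) : Prop :=
  MemLp g 2 (volume.restrict Ω) ∧
    ∀ φ : EuclideanSpace ℝ (Fin n) → ℝ, ContDiff ℝ ∞ φ → HasCompactSupport φ → tsupport φ ⊆ Ω →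
      ∫ x in Ω, u x * fderiv ℝ φ x (EuclideanSpace.single i 1) = - ∫ x in Ω, g x * φ x

/-- `u ∈ H¹(Ω)`: `u` and all its first order weak partial derivatives are in `L²(Ω)`. -/
def MemH1 {n : ℕ} (Ω : Set (EuclideanSpace ℝ (Fin n))) (u : EuclideanSpace ℝ (Fin n) → ℝ) : Prop :=
  MemLp u 2 (volume.restrict Ω) ∧ ∀ i : Fin n, ∃ g, IsWeakPartial Ω i u g

open Classical in
/-- The weak partial derivative `∂ᵢ u` (zero if it does not exist in `L²(Ω)`). -/
def weakPartial {n : ℕ} (Ω : Set (EuclideanSpace ℝ (Fin n))) (i : Fin n)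
    (u : EuclideanSpace ℝ (Fin n) → ℝ) : EuclideanSpace ℝ (Fin n) → ℝ :=
  if h : ∃ g, IsWeakPartial Ω i u g then h.choose else 0

/-- The seminorm of `H¹(Ω)`: `|u|_{H¹(Ω)} = (∑ᵢ ‖∂ᵢ u‖²_{L²(Ω)})^{1/2}`. -/
def h1Seminorm {n : ℕ} (Ω : Set (EuclideanSpace ℝ (Fin n)))
    (u : EuclideanSpace ℝ (Fin n) → ℝ) : ℝ :=
  Real.sqrt (∑ i : Fin n, l2Norm Ω (weakPartial Ω i u) ^ 2)

/-- Weak partial derivatives are unique almost everywhere, so that `h1Seminorm` does not depend on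
the choice made in `weakPartial`. -/
theorem IsWeakPartial.ae_eq_weakPartial {n : ℕ} {Ω : Set (EuclideanSpace ℝ (Fin n))}
    (hΩ : IsOpen Ω) {i : Fin n} {u g : EuclideanSpace ℝ (Fin n) → ℝ} (hg : IsWeakPartial Ω i u g) :
    g =ᵐ[volume.restrict Ω] weakPartial Ω i u := by
  have hex : ∃ g, IsWeakPartial Ω i u g := ⟨g, hg⟩
  have hw : IsWeakPartial Ω i u (weakPartial Ω i u) := by
    rw [weakPartial, dif_pos hex]
    exact hex.choose_spec
  generalize weakPartial Ω i u = w at hw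
  have hloc : ∀ f : EuclideanSpace ℝ (Fin n) → ℝ, MemLp f 2 (volume.restrict Ω) →
      LocallyIntegrable f (volume.restrict Ω) :=
    fun f hf => hf.locallyIntegrable (by norm_num)
  have key : ∀ᵐ x ∂(volume.restrict Ω), x ∈ Ω → (g - w) x = 0 := by
    refine hΩ.ae_eq_zero_of_integral_contDiff_smul_eq_zero
      (((hloc _ hg.1).sub (hloc _ hw.1)).locallyIntegrableOn Ω) ?_
    intro φ h1 h2 h3
    have hi : ∀ f, MemLp f 2 (volume.restrict Ω) →
        Integrable (fun x => φ x * f x) (volume.restrict Ω) := fun f hf => by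
      simpa using (hloc f hf).integrable_smul_left_of_hasCompactSupport h1.continuous h2
    have e := (hg.2 φ h1 h2 h3).symm.trans (hw.2 φ h1 h2 h3)
    simp only [Pi.sub_apply, smul_eq_mul, mul_sub]
    rw [integral_sub (hi g hg.1) (hi w hw.1)]
    simp only [mul_comm (φ _)]
    linarith
  filter_upwards [key, ae_restrict_mem hΩ.measurableSet] with x hx hxΩ
  have := hx hxΩ
  simp only [Pi.sub_apply] at this
  linarith

end

/-! Write `V = |Ω|/|B|` and `k = R/ρ`. If `u` has mean zero over `Ω`, expanding the square gives
`|B| ∫_Ω u² ≤ ∫_Ω ∫_B |u x - u y|²`. The segment from `x ∈ Ω` to `y ∈ B` stays in `Ω`, so the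
fundamental theorem of calculus and Jensen bound `|u x - u y|²` by `R²` times the average of `|∇u|²`
over it. For segment parameter at most `1/2` one substitutes in `x`, otherwise in `y`; either
Jacobian is at most `2^n`. Hence `K = √(2^n (1 + V))` works (`l2Norm_le_of_isStarShapedWrt`).

This needs `u` of class `C¹`. A weakly differentiable `u` is mollified on the points well inside
`Ω`, which are star shaped with respect to a slightly smaller ball; mollification does not increase
the `L²` norm of the gradient, and Fatou passes to the limit.

The stated bound is weaker than this one: `V ≤ (2k)^n` since `Ω` lies in a ball of radius `R`, and
this trades a small power of `V` for a factor `2k` (`sqrt_le_two_mul_mul_one_add_log_rpow`). -/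

/-! ### Differences of `C¹` functions along segments -/

/-- Jensen's inequality for the square, for a probability measure. -/
theorem lintegral_sq_le_of_isProbabilityMeasure {α : Type*} [MeasurableSpace α] (μ : Measure α)
    [IsProbabilityMeasure μ] {f : α → ENNReal} (hf : AEMeasurable f μ) :
    (∫⁻ x, f x ∂μ) ^ 2 ≤ ∫⁻ x, f x ^ 2 ∂μ := by
  have h := ENNReal.lintegral_mul_le_Lp_mul_Lq μ Real.HolderConjugate.two_two hf
    (aemeasurable_const (b := (1 : ENNReal)))
  simp only [Pi.mul_apply, mul_one, ENNReal.one_rpow, lintegral_const, measure_univ] at h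
  calc (∫⁻ x, f x ∂μ) ^ 2 ≤ ((∫⁻ x, f x ^ (2 : ℝ) ∂μ) ^ (1 / 2 : ℝ)) ^ 2 := by gcongr
    _ = ∫⁻ x, f x ^ (2 : ℝ) ∂μ := by
        rw [← ENNReal.rpow_natCast, ← ENNReal.rpow_mul]; norm_num
    _ = _ := by simp

theorem enorm_sub_sq_le_lintegral_segment {E : Type*} [NormedAddCommGroup E]
    [NormedSpace ℝ E] {w : E → ℝ} (hw : ContDiff ℝ 1 w) (x y : E) :
    ‖w x - w y‖ₑ ^ 2 ≤ ENNReal.ofReal (dist x y ^ 2) *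
      ∫⁻ s in Ioc (0 : ℝ) 1, ‖fderiv ℝ w ((1 - s) • x + s • y)‖ₑ ^ 2 := by
  have hc : Continuous fun s : ℝ => fderiv ℝ w ((1 - s) • x + s • y) :=
    (hw.continuous_fderiv one_ne_zero).comp (by fun_prop)
  have hγ : ∀ s : ℝ, HasDerivAt (fun s : ℝ => w ((1 - s) • x + s • y))
      (fderiv ℝ w ((1 - s) • x + s • y) (y - x)) s := fun s => by
    have h1 : HasDerivAt (fun s : ℝ => (1 - s) • x + s • y) (y - x) s := by
      have h2 := (((hasDerivAt_id s).const_sub 1).smul_const x).add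
        ((hasDerivAt_id s).smul_const y)
      rw [neg_one_smul, one_smul, neg_add_eq_sub] at h2
      exact h2
    exact ((hw.differentiable one_ne_zero) _).hasFDerivAt.comp_hasDerivAt s h1
  have hftc := intervalIntegral.integral_eq_sub_of_hasDerivAt (a := 0) (b := 1)
    (fun s _ => hγ s) ((hc.clm_apply continuous_const).intervalIntegrable 0 1)
  rw [intervalIntegral.integral_of_le zero_le_one] at hftc
  simp only [sub_self, zero_smul, one_smul, zero_add, sub_zero, add_zero] at hftc
  have : IsProbabilityMeasure (volume.restrict (Ioc (0 : ℝ) 1)) := ⟨by simp⟩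
  have hme : Measurable fun s : ℝ => ‖fderiv ℝ w ((1 - s) • x + s • y)‖ₑ := hc.enorm.measurable
  calc ‖w x - w y‖ₑ ^ 2
      = ‖∫ s in Ioc (0 : ℝ) 1, fderiv ℝ w ((1 - s) • x + s • y) (y - x)‖ₑ ^ 2 := by
        rw [hftc, ← enorm_neg, neg_sub]
    _ ≤ (∫⁻ s in Ioc (0 : ℝ) 1, ‖fderiv ℝ w ((1 - s) • x + s • y)‖ₑ * ‖y - x‖ₑ) ^ 2 := by
        gcongr
        exact (enorm_integral_le_lintegral_enorm _).trans
          (lintegral_mono fun s => ContinuousLinearMap.le_opENorm _ _)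
    _ = ‖y - x‖ₑ ^ 2 * (∫⁻ s in Ioc (0 : ℝ) 1, ‖fderiv ℝ w ((1 - s) • x + s • y)‖ₑ) ^ 2 := by
        rw [lintegral_mul_const _ hme, mul_pow, mul_comm]
    _ ≤ ‖y - x‖ₑ ^ 2 * ∫⁻ s in Ioc (0 : ℝ) 1, ‖fderiv ℝ w ((1 - s) • x + s • y)‖ₑ ^ 2 := by
        gcongr
        exact lintegral_sq_le_of_isProbabilityMeasure _ hme.aemeasurable
    _ = _ := by
        rw [← ofReal_norm, ← ENNReal.ofReal_pow (norm_nonneg _), ← dist_eq_norm, dist_comm]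

section Segments

variable {E : Type*} [NormedAddCommGroup E] [NormedSpace ℝ E] [MeasurableSpace E] [BorelSpace E]
  [FiniteDimensional ℝ E] (μ : Measure E) [μ.IsAddHaarMeasure]

/-- The substitution has Jacobian `a⁻ⁿ`, which is at most `2ⁿ` because `a` stays away from zero. -/
theorem lintegral_comp_smul_add_le {F : E → ENNReal} (hF : Measurable F) {a : ℝ}
    (ha : 1 / 2 ≤ a) (b : E) :
    ∫⁻ x, F (a • x + b) ∂μ ≤ 2 ^ Module.finrank ℝ E * ∫⁻ x, F x ∂μ := by
  have ha0 : 0 < a := by linarith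
  have h1 : ∫⁻ x, F (a • x + b) ∂μ = ∫⁻ x, F (x + b) ∂(Measure.map (fun x => a • x) μ) := by
    rw [lintegral_map (f := fun x => F (x + b)) (hF.comp (by fun_prop)) (measurable_const_smul a)]
  rw [h1, Measure.map_addHaar_smul μ ha0.ne', lintegral_smul_measure,
    lintegral_add_right_eq_self F b, smul_eq_mul]
  gcongr
  rw [abs_of_nonneg (by positivity), ← inv_pow]
  calc ENNReal.ofReal (a⁻¹ ^ Module.finrank ℝ E)
      ≤ ENNReal.ofReal (2 ^ Module.finrank ℝ E) := by
        gcongr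
        rw [inv_le_comm₀ ha0 two_pos]; linarith
    _ = _ := by rw [ENNReal.ofReal_pow (by norm_num)]; norm_num

/-- The average of `F` over all segments between two sets is controlled by its integral. -/
theorem lintegral_segments_le {F : E → ENNReal} (hF : Measurable F) (A B : Set E) :
    ∫⁻ x in A, ∫⁻ y in B, ∫⁻ s in Ioc (0 : ℝ) 1, F ((1 - s) • x + s • y) ∂volume ∂μ ∂μ ≤
      2 ^ Module.finrank ℝ E * (μ A + μ B) * ∫⁻ z, F z ∂μ := by
  have hslice : ∀ s : ℝ, ∫⁻ x in A, ∫⁻ y in B, F ((1 - s) • x + s • y) ∂μ ∂μ ≤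
      2 ^ Module.finrank ℝ E * (μ A + μ B) * ∫⁻ z, F z ∂μ := by
    intro s
    -- The larger of the coefficients `1 - s` and `s` is at least `1/2`; substitute in the variable
    -- carrying it.
    rcases le_total s (1 / 2) with hs | hs
    · have h0 : Measurable fun p : E × E => F ((1 - s) • p.1 + s • p.2) := hF.comp (by fun_prop)
      rw [lintegral_lintegral_swap h0.aemeasurable]
      calc ∫⁻ y in B, ∫⁻ x in A, F ((1 - s) • x + s • y) ∂μ ∂μ
          ≤ ∫⁻ _ in B, 2 ^ Module.finrank ℝ E * ∫⁻ x, F x ∂μ ∂μ :=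
            lintegral_mono fun y => (setLIntegral_le_lintegral _ _).trans
              (lintegral_comp_smul_add_le μ hF (by linarith) _)
        _ = 2 ^ Module.finrank ℝ E * μ B * ∫⁻ z, F z ∂μ := by
            rw [setLIntegral_const]; ring
        _ ≤ _ := by gcongr; exact le_add_self
    · calc ∫⁻ x in A, ∫⁻ y in B, F ((1 - s) • x + s • y) ∂μ ∂μ
          ≤ ∫⁻ _ in A, 2 ^ Module.finrank ℝ E * ∫⁻ x, F x ∂μ ∂μ := by
            refine lintegral_mono fun x => (setLIntegral_le_lintegral _ _).trans ?_
            simp only [add_comm ((1 - s) • x)]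
            exact lintegral_comp_smul_add_le μ hF hs _
        _ = 2 ^ Module.finrank ℝ E * μ A * ∫⁻ z, F z ∂μ := by
            rw [setLIntegral_const]; ring
        _ ≤ _ := by gcongr; exact le_self_add
  have hswap : ∫⁻ x in A, ∫⁻ y in B, ∫⁻ s in Ioc (0 : ℝ) 1, F ((1 - s) • x + s • y) ∂volume ∂μ ∂μ =
      ∫⁻ s in Ioc (0 : ℝ) 1, ∫⁻ x in A, ∫⁻ y in B, F ((1 - s) • x + s • y) ∂μ ∂μ := by
    have h1 : ∀ x, ∫⁻ y in B, ∫⁻ s in Ioc (0 : ℝ) 1, F ((1 - s) • x + s • y) ∂volume ∂μ =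
        ∫⁻ s in Ioc (0 : ℝ) 1, ∫⁻ y in B, F ((1 - s) • x + s • y) ∂μ := fun x => by
      have h0 : Measurable fun p : E × ℝ => F ((1 - p.2) • x + p.2 • p.1) := hF.comp (by fun_prop)
      exact lintegral_lintegral_swap h0.aemeasurable
    simp only [h1]
    refine lintegral_lintegral_swap (Measurable.aemeasurable ?_)
    have h2 : Measurable fun p : (E × ℝ) × E => F ((1 - p.1.2) • p.1.1 + p.1.2 • p.2) :=
      hF.comp (by fun_prop)
    exact h2.lintegral_prod_right'
  rw [hswap]
  calc _ ≤ ∫⁻ _ in Ioc (0 : ℝ) 1, 2 ^ Module.finrank ℝ E * (μ A + μ B) * ∫⁻ z, F z ∂μ :=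
        lintegral_mono hslice
    _ = _ := by simp

/-- The Poincaré inequality for differences, for continuously differentiable functions. -/
theorem lintegral_enorm_sub_sq_le {w : E → ℝ} (hw : ContDiff ℝ 1 w) {A B : Set E}
    (hA : MeasurableSet A) (hB : MeasurableSet B)
    (hAB : ∀ x ∈ A, ∀ y ∈ B, ∀ s ∈ Ioc (0 : ℝ) 1, (1 - s) • x + s • y ∈ A) {R : ℝ}
    (hR : ∀ x ∈ A, ∀ y ∈ B, dist x y ≤ R) :
    ∫⁻ x in A, ∫⁻ y in B, ‖w x - w y‖ₑ ^ 2 ∂μ ∂μ ≤ ENNReal.ofReal (R ^ 2) *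
      (2 ^ Module.finrank ℝ E * (μ A + μ B) * ∫⁻ z in A, ‖fderiv ℝ w z‖ₑ ^ 2 ∂μ) := by
  have hm : Measurable fun z => ‖fderiv ℝ w z‖ₑ ^ 2 :=
    (hw.continuous_fderiv one_ne_zero).enorm.measurable.pow_const 2
  -- Cutting off outside `A` costs nothing, as the segments stay in `A`, and permits substitution
  -- over the whole space.
  set F : E → ENNReal := A.indicator fun z => ‖fderiv ℝ w z‖ₑ ^ 2 with hFdef
  have hF : Measurable F := hm.indicator hA
  rw [show ∫⁻ z in A, ‖fderiv ℝ w z‖ₑ ^ 2 ∂μ = ∫⁻ z, F z ∂μ from (lintegral_indicator hA _).symm]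
  refine le_trans ?_ (mul_le_mul_right (lintegral_segments_le μ hF A B) _)
  rw [← lintegral_const_mul' _ _ ENNReal.ofReal_ne_top]
  refine setLIntegral_mono' hA fun x hx => ?_
  rw [← lintegral_const_mul' _ _ ENNReal.ofReal_ne_top]
  refine setLIntegral_mono' hB fun y hy => ?_
  refine (enorm_sub_sq_le_lintegral_segment hw x y).trans (mul_le_mul'
    (ENNReal.ofReal_le_ofReal (pow_le_pow_left₀ dist_nonneg (hR x hx y hy) 2))
    (setLIntegral_mono' measurableSet_Ioc fun s hs => ?_))
  rw [hFdef, indicator_of_mem (hAB x hx y hy s hs)]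

end Segments

/-! ### Mollification of weak derivatives -/

section Mollification

variable {n : ℕ}

/-- Jensen for the probability measure with density `ψ (z - ·)`. -/
theorem sq_lintegral_mollifier_le {ψ : EuclideanSpace ℝ (Fin n) → ℝ} (hψ : Continuous ψ)
    (h1 : ∫⁻ y, ENNReal.ofReal (ψ y) = 1) {h : EuclideanSpace ℝ (Fin n) → ENNReal}
    (hh : AEMeasurable h) (z : EuclideanSpace ℝ (Fin n)) :
    (∫⁻ y, ENNReal.ofReal (ψ (z - y)) * h y) ^ 2 ≤
      ∫⁻ y, ENNReal.ofReal (ψ (z - y)) * h y ^ 2 := by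
  set d : EuclideanSpace ℝ (Fin n) → ENNReal := fun y => ENNReal.ofReal (ψ (z - y)) with hd
  have hdm : Measurable d :=
    ENNReal.measurable_ofReal.comp (hψ.comp (continuous_const.sub continuous_id)).measurable
  have hprob : IsProbabilityMeasure (volume.withDensity d) := ⟨by
    rw [withDensity_apply _ MeasurableSet.univ, setLIntegral_univ, hd,
      lintegral_sub_left_eq_self (fun y => ENNReal.ofReal (ψ y)), h1]⟩
  have hj := lintegral_sq_le_of_isProbabilityMeasure (volume.withDensity d)
    (hh.mono_ac (withDensity_absolutelyContinuous _ _))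
  rw [lintegral_withDensity_eq_lintegral_mul₀ hdm.aemeasurable hh,
    lintegral_withDensity_eq_lintegral_mul₀ hdm.aemeasurable (hh.pow_const 2)] at hj
  exact hj

theorem lintegral_mollifier {ψ : EuclideanSpace ℝ (Fin n) → ℝ} (hψ : Continuous ψ)
    (h1 : ∫⁻ y, ENNReal.ofReal (ψ y) = 1) {h : EuclideanSpace ℝ (Fin n) → ENNReal}
    (hh : AEMeasurable h) :
    ∫⁻ z, ∫⁻ y, ENNReal.ofReal (ψ (z - y)) * h y = ∫⁻ y, h y := by
  have hc : Measurable fun p : EuclideanSpace ℝ (Fin n) × EuclideanSpace ℝ (Fin n) =>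
      ENNReal.ofReal (ψ (p.1 - p.2)) :=
    ENNReal.measurable_ofReal.comp (hψ.comp (by fun_prop)).measurable
  rw [lintegral_lintegral_swap (hc.aemeasurable.mul hh.comp_snd)]
  refine lintegral_congr fun y => ?_
  have h2 : ∫⁻ z, ENNReal.ofReal (ψ (z - y)) = 1 := by
    rw [← h1]
    exact lintegral_sub_right_eq_self (fun z => ENNReal.ofReal (ψ z)) y
  have hm : Measurable fun z => ENNReal.ofReal (ψ (z - y)) :=
    ENNReal.measurable_ofReal.comp (hψ.comp (by fun_prop)).measurable
  rw [lintegral_mul_const _ hm, h2, one_mul]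

/-- Cauchy–Schwarz in coordinates; it passes from the operator norm of the derivative to the partial
derivatives. -/
theorem enorm_sq_le_sum_apply_single (T : EuclideanSpace ℝ (Fin n) →L[ℝ] ℝ) :
    ‖T‖ₑ ^ 2 ≤ ∑ i, ‖T (EuclideanSpace.single i 1)‖ₑ ^ 2 := by
  have key : ‖T‖ ^ 2 ≤ ∑ i, T (EuclideanSpace.single i 1) ^ 2 := by
    have h0 : 0 ≤ ∑ i, T (EuclideanSpace.single i 1) ^ 2 := Finset.sum_nonneg fun i _ => sq_nonneg _
    have : ‖T‖ ≤ √(∑ i, T (EuclideanSpace.single i 1) ^ 2) := by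
      refine T.opNorm_le_bound (Real.sqrt_nonneg _) fun v => ?_
      have hv : T v = ∑ i, T (EuclideanSpace.single i 1) * v i := by
        conv_lhs => rw [← (EuclideanSpace.basisFun (Fin n) ℝ).sum_repr v]
        simp [mul_comm]
      rw [hv, EuclideanSpace.norm_eq, ← Real.sqrt_mul h0, Real.norm_eq_abs]
      refine Real.abs_le_sqrt ?_
      simpa using Finset.sum_mul_sq_le_sq_mul_sq Finset.univ
        (fun i => T (EuclideanSpace.single i 1)) v
    calc ‖T‖ ^ 2 ≤ √(∑ i, T (EuclideanSpace.single i 1) ^ 2) ^ 2 := by gcongr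
      _ = _ := Real.sq_sqrt h0
  have h2 := ENNReal.ofReal_le_ofReal key
  rw [ENNReal.ofReal_sum_of_nonneg fun i _ => sq_nonneg _] at h2
  simpa [← ofReal_norm, ← ENNReal.ofReal_pow] using h2

/-- The derivative of a mollification of `u`, away from the boundary of `Ω`, is the mollification
of the weak derivative. -/
theorem IsWeakPartial.fderiv_convolution_apply {Ω : Set (EuclideanSpace ℝ (Fin n))}
    (hΩ : MeasurableSet Ω) {i : Fin n} {u g : EuclideanSpace ℝ (Fin n) → ℝ}
    (hu : LocallyIntegrable (Ω.indicator u)) (hg : IsWeakPartial Ω i u g)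
    {ψ : EuclideanSpace ℝ (Fin n) → ℝ} (hψ : ContDiff ℝ ∞ ψ) {ρ : ℝ}
    (hsupp : Function.support ψ ⊆ Metric.closedBall 0 ρ) {z : EuclideanSpace ℝ (Fin n)}
    (hz : Metric.closedBall z ρ ⊆ Ω) :
    fderiv ℝ (convolution (Ω.indicator u) ψ (ContinuousLinearMap.lsmul ℝ ℝ).flip volume) z
      (EuclideanSpace.single i 1) = ∫ y in Ω, g y * ψ (z - y) := by
  have hcs : HasCompactSupport ψ :=
    HasCompactSupport.of_support_subset_isCompact (isCompact_closedBall 0 ρ) hsupp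
  have hsupp' : Function.support (fun y => ψ (z - y)) ⊆ Metric.closedBall z ρ := fun y hy => by
    have := hsupp (show z - y ∈ Function.support ψ from hy)
    rw [mem_closedBall_zero_iff] at this
    rwa [mem_closedBall_iff_norm, norm_sub_rev]
  -- The reflected kernel `y ↦ ψ (z - y)` is an admissible test function because its support lies in
  -- the ball around `z`.
  have htest := hg.2 (fun y => ψ (z - y)) (hψ.comp (contDiff_const.sub contDiff_id))
    (HasCompactSupport.of_support_subset_isCompact (isCompact_closedBall z ρ) hsupp')
    ((closure_minimal hsupp' Metric.isClosed_closedBall).trans hz)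
  rw [(hcs.hasFDerivAt_convolution_right _ hu (hψ.of_le (by simp)) z).fderiv,
    convolution_precompR_apply _ hu (hcs.fderiv ℝ)
      (hψ.continuous_fderiv (by simp)), convolution_def,
    ← neg_inj, ← htest, ← integral_neg, ← integral_indicator hΩ]
  refine integral_congr_ae (Filter.Eventually.of_forall fun y => ?_)
  have hd : fderiv ℝ (fun y => ψ (z - y)) y = -fderiv ℝ ψ (z - y) := by
    have h1 := (hψ.differentiable (by simp) (z - y)).hasFDerivAt.comp y
      ((hasFDerivAt_id y).const_sub z)
    rw [show (fun y => ψ (z - y)) = ψ ∘ fun y => z - y from rfl]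
    refine h1.fderiv.trans ?_
    ext v; simp
  by_cases hy : y ∈ Ω <;> simp [hy, hd, mul_comm]

theorem enorm_sq_setIntegral_mollifier_le {Ω : Set (EuclideanSpace ℝ (Fin n))}
    (hΩ : MeasurableSet Ω) {g : EuclideanSpace ℝ (Fin n) → ℝ}
    (hg : AEStronglyMeasurable g (volume.restrict Ω))
    {ψ : EuclideanSpace ℝ (Fin n) → ℝ} (hψ : Continuous ψ) (hpos : ∀ y, 0 ≤ ψ y)
    (h1 : ∫⁻ y, ENNReal.ofReal (ψ y) = 1) (z : EuclideanSpace ℝ (Fin n)) :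
    ‖∫ y in Ω, g y * ψ (z - y)‖ₑ ^ 2 ≤
      ∫⁻ y, ENNReal.ofReal (ψ (z - y)) * Ω.indicator (fun y => ‖g y‖ₑ ^ 2) y := by
  have hm : AEMeasurable (Ω.indicator fun y => ‖g y‖ₑ) :=
    (aemeasurable_indicator_iff hΩ).2 hg.enorm
  calc ‖∫ y in Ω, g y * ψ (z - y)‖ₑ ^ 2
      ≤ (∫⁻ y in Ω, ‖g y * ψ (z - y)‖ₑ) ^ 2 := by
        gcongr; exact enorm_integral_le_lintegral_enorm _
    _ = (∫⁻ y, ENNReal.ofReal (ψ (z - y)) * Ω.indicator (fun y => ‖g y‖ₑ) y) ^ 2 := by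
        rw [← lintegral_indicator hΩ]
        congr 1
        refine lintegral_congr fun y => ?_
        by_cases hy : y ∈ Ω
        · simp [hy, Real.enorm_of_nonneg (hpos (z - y)), mul_comm]
        · simp [hy]
    _ ≤ _ := sq_lintegral_mollifier_le hψ h1 hm z
    _ = _ := by
        refine lintegral_congr fun y => ?_
        by_cases hy : y ∈ Ω <;> simp [hy]

/-- Away from the boundary of `Ω`, the gradient of a mollification of `u` is bounded in `L²` by the
weak gradient. -/
theorem lintegral_fderiv_convolution_le {Ω A : Set (EuclideanSpace ℝ (Fin n))}
    (hΩ : MeasurableSet Ω) (hA : MeasurableSet A) {u : EuclideanSpace ℝ (Fin n) → ℝ}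
    {g : Fin n → EuclideanSpace ℝ (Fin n) → ℝ}
    (hu : LocallyIntegrable (Ω.indicator u)) (hg : ∀ i, IsWeakPartial Ω i u (g i))
    {ψ : EuclideanSpace ℝ (Fin n) → ℝ} (hψ : ContDiff ℝ ∞ ψ) (hpos : ∀ y, 0 ≤ ψ y)
    (h1 : ∫⁻ y, ENNReal.ofReal (ψ y) = 1) {ρ : ℝ}
    (hsupp : Function.support ψ ⊆ Metric.closedBall 0 ρ)
    (hAΩ : ∀ z ∈ A, Metric.closedBall z ρ ⊆ Ω) :
    ∫⁻ z in A, ‖fderiv ℝ (convolution (Ω.indicator u) ψ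
        (ContinuousLinearMap.lsmul ℝ ℝ).flip volume) z‖ₑ ^ 2 ≤
      ∑ i, ∫⁻ y in Ω, ‖g i y‖ₑ ^ 2 := by
  have hm : ∀ i, AEMeasurable (Ω.indicator fun y => ‖g i y‖ₑ ^ 2) := fun i =>
    (aemeasurable_indicator_iff hΩ).2 ((hg i).1.1.enorm.pow_const 2)
  have hc : Measurable fun p : EuclideanSpace ℝ (Fin n) × EuclideanSpace ℝ (Fin n) =>
      ENNReal.ofReal (ψ (p.1 - p.2)) :=
    ENNReal.measurable_ofReal.comp (hψ.continuous.comp (by fun_prop)).measurable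
  calc _ ≤ ∫⁻ z in A, ∑ i, ∫⁻ y, ENNReal.ofReal (ψ (z - y)) *
          Ω.indicator (fun y => ‖g i y‖ₑ ^ 2) y := by
        refine setLIntegral_mono' hA fun z hz => (enorm_sq_le_sum_apply_single _).trans ?_
        refine Finset.sum_le_sum fun i _ => ?_
        rw [(hg i).fderiv_convolution_apply hΩ hu hψ hsupp (hAΩ z hz)]
        exact enorm_sq_setIntegral_mollifier_le hΩ (hg i).1.1 hψ.continuous hpos h1 z
    _ ≤ ∫⁻ z, ∑ i, ∫⁻ y, ENNReal.ofReal (ψ (z - y)) *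
          Ω.indicator (fun y => ‖g i y‖ₑ ^ 2) y := setLIntegral_le_lintegral _ _
    _ = ∑ i, ∫⁻ z, ∫⁻ y, ENNReal.ofReal (ψ (z - y)) *
          Ω.indicator (fun y => ‖g i y‖ₑ ^ 2) y :=
        lintegral_finsetSum' _ fun i _ =>
          (hc.aemeasurable.mul (hm i).comp_snd).lintegral_prod_right'
    _ = _ := by
        refine Finset.sum_congr rfl fun i _ => ?_
        rw [lintegral_mollifier hψ.continuous h1 (hm i), lintegral_indicator hΩ]

end Mollification

/-! ### Star shaped sets and passage to weak derivatives -/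

section StarShaped

variable {n : ℕ}

theorem IsStarShapedWrt.segment_mem {Ω B : Set (EuclideanSpace ℝ (Fin n))}
    (h : IsStarShapedWrt Ω B) {x y : EuclideanSpace ℝ (Fin n)} (hx : x ∈ Ω) (hy : y ∈ B) {s : ℝ}
    (hs : s ∈ Ioc (0 : ℝ) 1) : (1 - s) • x + s • y ∈ Ω :=
  h.2 x hx ((convex_convexHull ℝ (B ∪ {x})) (subset_convexHull ℝ _ (mem_union_right _ rfl))
    (subset_convexHull ℝ _ (mem_union_left _ hy)) (by linarith [hs.2]) hs.1.le (by ring))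

/-- The points of a star shaped set at distance at least `δ` from its complement are star shaped
with respect to a smaller ball. -/
theorem IsStarShapedWrt.segment_mem_of_le_dist {Ω : Set (EuclideanSpace ℝ (Fin n))}
    {x₀ : EuclideanSpace ℝ (Fin n)} {r δ : ℝ} (h : IsStarShapedWrt Ω (Metric.ball x₀ r))
    {x y : EuclideanSpace ℝ (Fin n)} (hx : ∀ z ∉ Ω, δ ≤ dist x z)
    (hy : y ∈ Metric.ball x₀ (r - δ)) {s : ℝ} (hs : s ∈ Ioc (0 : ℝ) 1) :
    ∀ z ∉ Ω, δ ≤ dist ((1 - s) • x + s • y) z := by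
  intro z hz
  by_contra! hlt
  set v := z - ((1 - s) • x + s • y) with hv
  have hvn : ‖v‖ < δ := by rwa [hv, ← dist_eq_norm, dist_comm]
  -- Translate the whole segment by the short vector `v`: its endpoints remain in `Ω` and in the
  -- ball, so the translated point `z` would lie in `Ω`.
  have hxv : x + v ∈ Ω := by
    by_contra hn
    have := hx _ hn
    rw [dist_self_add_right] at this
    linarith
  have hyv : y + v ∈ Metric.ball x₀ r := by
    rw [Metric.mem_ball] at hy ⊢
    calc dist (y + v) x₀ ≤ dist (y + v) y + dist y x₀ := dist_triangle _ _ _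
      _ < r := by rw [dist_self_add_left]; linarith
  apply hz
  have := h.segment_mem hxv hyv hs
  convert this using 1
  rw [show (1 - s) • (x + v) + s • (y + v) = ((1 - s) • x + s • y) + v by module, hv]
  abel

/-- The Poincaré inequality for differences, for functions with weak derivatives in `L²`. -/
theorem lintegral_enorm_sub_sq_le_of_isWeakPartial {Ω : Set (EuclideanSpace ℝ (Fin n))}
    {x₀ : EuclideanSpace ℝ (Fin n)} {r : ℝ} (hΩ : IsOpen Ω) (hb : Bornology.IsBounded Ω)
    (hstar : IsStarShapedWrt Ω (Metric.ball x₀ r)) {u : EuclideanSpace ℝ (Fin n) → ℝ}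
    (hu : MemLp u 2 (volume.restrict Ω)) {g : Fin n → EuclideanSpace ℝ (Fin n) → ℝ}
    (hg : ∀ i, IsWeakPartial Ω i u (g i)) :
    ∫⁻ p, ‖u p.1 - u p.2‖ₑ ^ 2
        ∂((volume.restrict Ω).prod (volume.restrict (Metric.ball x₀ r))) ≤
      ENNReal.ofReal (Metric.diam Ω ^ 2) *
        (2 ^ n * (volume Ω + volume (Metric.ball x₀ r)) * ∑ i, ∫⁻ y in Ω, ‖g i y‖ₑ ^ 2) := by
  set B := Metric.ball x₀ r with hB
  have hBΩ : B ⊆ Ω := hstar.1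
  have hfin : volume Ω < ⊤ := hb.measure_lt_top
  have hloc : LocallyIntegrable (Ω.indicator u) := by
    have : IsFiniteMeasure (volume.restrict Ω) := ⟨by simpa using hfin⟩
    exact ((integrable_indicator_iff hΩ.measurableSet).2
      (hu.integrable (by norm_num))).locallyIntegrable
  set δ : ℕ → ℝ := fun k => 1 / ((k : ℝ) + 1) with hδ
  have hδpos : ∀ k, 0 < δ k := fun k => Nat.one_div_pos_of_nat
  have hδlim : Filter.Tendsto δ Filter.atTop (nhds 0) := tendsto_one_div_add_atTop_nhds_zero_nat
  -- The fixed ratio `2` of the two radii is what almost everywhere convergence of the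
  -- mollifications requires.
  let φ : ℕ → ContDiffBump (0 : EuclideanSpace ℝ (Fin n)) := fun k =>
    ⟨δ k / 2, δ k, half_pos (hδpos k), half_lt_self (hδpos k)⟩
  set ψ : ℕ → EuclideanSpace ℝ (Fin n) → ℝ := fun k => (φ k).normed volume with hψ
  have hψs : ∀ k, ContDiff ℝ ∞ (ψ k) := fun k => (φ k).contDiff_normed
  set w : ℕ → EuclideanSpace ℝ (Fin n) → ℝ := fun k =>
    convolution (Ω.indicator u) (ψ k) (ContinuousLinearMap.lsmul ℝ ℝ).flip volume with hw
  have hψ1 : ∀ k, ∫⁻ y, ENNReal.ofReal (ψ k y) = 1 := fun k => by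
    rw [← ofReal_integral_eq_lintegral_ofReal (φ k).integrable_normed
      (Filter.Eventually.of_forall (φ k).nonneg_normed), (φ k).integral_normed, ENNReal.ofReal_one]
  have hws : ∀ k, ContDiff ℝ 1 (w k) := fun k =>
    (φ k).hasCompactSupport_normed.contDiff_convolution_right _ hloc ((hψs k).of_le (by simp))
  have hlim : ∀ᵐ x, Filter.Tendsto (fun k => w k x) Filter.atTop (nhds (Ω.indicator u x)) := by
    have := ContDiffBump.ae_convolution_tendsto_right_of_locallyIntegrable (φ := φ) (K := 2)
      hδlim (Filter.Eventually.of_forall fun k => by change δ k ≤ 2 * (δ k / 2); linarith) hloc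
    filter_upwards [this] with x hx
    simpa only [hw, hψ, convolution_flip] using hx
  set A : ℕ → Set (EuclideanSpace ℝ (Fin n)) := fun k => {x | ∀ z ∉ Ω, 2 * δ k ≤ dist x z} with hA
  have hAm : ∀ k, MeasurableSet (A k) := fun k => by
    have : A k = ⋂ z ∈ Ωᶜ, {x | 2 * δ k ≤ dist x z} := by ext; simp [hA]
    rw [this]
    exact (isClosed_biInter fun z _ =>
      isClosed_le continuous_const (continuous_id.dist continuous_const)).measurableSet
  have hAΩ : ∀ k, A k ⊆ Ω := fun k x hx => by
    by_contra hn
    have := hx x hn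
    rw [dist_self] at this
    linarith [hδpos k]
  have hball : ∀ k, ∀ z ∈ A k, Metric.closedBall z (δ k) ⊆ Ω := fun k z hz y hy => by
    by_contra hn
    have := hz y hn
    rw [Metric.mem_closedBall, dist_comm] at hy
    linarith [hδpos k]
  have hBk : ∀ k, Metric.ball x₀ (r - 2 * δ k) ⊆ B := fun k =>
    Metric.ball_subset_ball (by linarith [hδpos k])
  have hbound : ∀ k, ∫⁻ x in A k, ∫⁻ y in Metric.ball x₀ (r - 2 * δ k), ‖w k x - w k y‖ₑ ^ 2 ≤
      ENNReal.ofReal (Metric.diam Ω ^ 2) *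
        (2 ^ n * (volume Ω + volume B) * ∑ i, ∫⁻ y in Ω, ‖g i y‖ₑ ^ 2) := fun k => by
    refine (lintegral_enorm_sub_sq_le volume (hws k) (hAm k) measurableSet_ball
      (fun x hx y hy s hs => hstar.segment_mem_of_le_dist hx hy hs)
      (fun x hx y hy => Metric.dist_le_diam_of_mem hb (hAΩ k hx) (hBΩ (hBk k hy)))).trans ?_
    rw [finrank_euclideanSpace_fin]
    refine mul_le_mul' le_rfl (mul_le_mul' (mul_le_mul' le_rfl
      (add_le_add (measure_mono (hAΩ k)) (measure_mono (hBk k)))) ?_)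
    exact lintegral_fderiv_convolution_le hΩ.measurableSet (hAm k) hloc hg (hψs k)
      (φ k).nonneg_normed (hψ1 k)
      ((φ k).support_normed_eq.trans_subset Metric.ball_subset_closedBall) (hball k)
  set f : ℕ → EuclideanSpace ℝ (Fin n) × EuclideanSpace ℝ (Fin n) → ENNReal := fun k =>
    (A k ×ˢ Metric.ball x₀ (r - 2 * δ k)).indicator fun p => ‖w k p.1 - w k p.2‖ₑ ^ 2 with hf
  have hwm : ∀ k, Measurable fun p : EuclideanSpace ℝ (Fin n) × EuclideanSpace ℝ (Fin n) =>
      ‖w k p.1 - w k p.2‖ₑ ^ 2 := fun k =>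
    (((hws k).continuous.comp continuous_fst).sub
      ((hws k).continuous.comp continuous_snd)).enorm.measurable.pow_const 2
  have hSm : ∀ k, MeasurableSet (A k ×ˢ Metric.ball x₀ (r - 2 * δ k)) := fun k =>
    (hAm k).prod measurableSet_ball
  have hfint : ∀ k, ∫⁻ p, f k p ∂((volume.restrict Ω).prod (volume.restrict B)) ≤
      ENNReal.ofReal (Metric.diam Ω ^ 2) *
        (2 ^ n * (volume Ω + volume B) * ∑ i, ∫⁻ y in Ω, ‖g i y‖ₑ ^ 2) := fun k => by
    refine le_trans ?_ (hbound k)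
    rw [Measure.prod_restrict]
    refine (setLIntegral_le_lintegral _ _).trans_eq ?_
    rw [hf, lintegral_indicator (hSm k), ← Measure.prod_restrict,
      lintegral_prod _ (hwm k).aemeasurable]
  have hae : ∀ᵐ p ∂((volume.restrict Ω).prod (volume.restrict B)),
      ‖u p.1 - u p.2‖ₑ ^ 2 = Filter.liminf (fun k => f k p) Filter.atTop := by
    have h1 : ∀ᵐ x ∂(volume.restrict Ω), x ∈ Ω ∧
        Filter.Tendsto (fun k => w k x) Filter.atTop (nhds (Ω.indicator u x)) :=
      (ae_restrict_mem hΩ.measurableSet).and (ae_restrict_of_ae hlim)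
    have h2 : ∀ᵐ x ∂(volume.restrict B), x ∈ B ∧
        Filter.Tendsto (fun k => w k x) Filter.atTop (nhds (Ω.indicator u x)) :=
      (ae_restrict_mem measurableSet_ball).and (ae_restrict_of_ae hlim)
    filter_upwards [Measure.quasiMeasurePreserving_fst.ae h1,
      Measure.quasiMeasurePreserving_snd.ae h2] with p hp1 hp2
    have ht : Filter.Tendsto (fun k => ‖w k p.1 - w k p.2‖ₑ ^ 2) Filter.atTop
        (nhds (‖u p.1 - u p.2‖ₑ ^ 2)) := by
      have h3 := hp1.2.sub hp2.2
      rw [indicator_of_mem hp1.1, indicator_of_mem (hBΩ hp2.1)] at h3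
      exact ((ENNReal.continuous_pow 2).tendsto _).comp h3.enorm
    refine (Filter.Tendsto.liminf_eq (ht.congr' ?_)).symm
    -- Both `Ω` and `B` are open, so `p` eventually lies in the truncated domain and the cutoff in
    -- `f k` disappears.
    obtain ⟨ε, hε, hεΩ⟩ := Metric.isOpen_iff.1 hΩ p.1 hp1.1
    have hp2' : 0 < r - dist p.2 x₀ := by linarith [Metric.mem_ball.1 hp2.1]
    filter_upwards [hδlim.eventually_lt_const (half_pos hε),
      hδlim.eventually_lt_const (half_pos hp2')] with k hk1 hk2
    have hmem : p ∈ A k ×ˢ Metric.ball x₀ (r - 2 * δ k) := by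
      refine ⟨fun z hz => ?_, ?_⟩
      · by_contra! hlt
        exact hz (hεΩ (by rw [Metric.mem_ball, dist_comm]; linarith))
      · rw [Metric.mem_ball]; linarith
    simp only [hf, indicator_of_mem hmem]
  rw [lintegral_congr_ae hae]
  -- Fatou's lemma.
  refine (lintegral_liminf_le fun k => (hwm k).indicator (hSm k)).trans ?_
  exact (Filter.liminf_le_liminf (Filter.Eventually.of_forall hfint)).trans_eq
    (Filter.liminf_const _)

/-! ### From differences to the Poincaré inequality -/

theorem sq_l2Norm (Ω : Set (EuclideanSpace ℝ (Fin n))) (u : EuclideanSpace ℝ (Fin n) → ℝ) :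
    l2Norm Ω u ^ 2 = (∫⁻ x in Ω, ‖u x‖ₑ ^ 2).toReal := by
  rw [l2Norm, ← ENNReal.toReal_pow, eLpNorm_eq_lintegral_rpow_enorm_toReal (by norm_num) (by norm_num),
    ← ENNReal.rpow_natCast, ← ENNReal.rpow_mul]
  norm_num

/-- A function of mean zero is dominated in `L²` by its differences. -/
theorem measureReal_mul_integral_sq_le {α : Type*} [MeasurableSpace α] {μ ν : Measure α}
    [IsFiniteMeasure μ] [IsFiniteMeasure ν] {u : α → ℝ} (hu : MemLp u 2 μ) (hv : MemLp u 2 ν)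
    (h0 : ∫ x, u x ∂μ = 0) :
    ν.real univ * ∫ x, u x ^ 2 ∂μ ≤ ∫ p, (u p.1 - u p.2) ^ 2 ∂(μ.prod ν) ∧
      Integrable (fun p : α × α => (u p.1 - u p.2) ^ 2) (μ.prod ν) := by
  have i1 : Integrable (fun p : α × α => u p.1 ^ 2) (μ.prod ν) := by
    simpa using hu.integrable_sq.mul_prod (integrable_const (μ := ν) (1 : ℝ))
  have i2 : Integrable (fun p : α × α => u p.2 ^ 2) (μ.prod ν) := by
    simpa using (integrable_const (μ := μ) (1 : ℝ)).mul_prod hv.integrable_sq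
  have i3 : Integrable (fun p : α × α => u p.1 * u p.2) (μ.prod ν) :=
    (hu.integrable (by norm_num)).mul_prod (hv.integrable (by norm_num))
  have e : (fun p : α × α => (u p.1 - u p.2) ^ 2) =
      fun p => u p.1 ^ 2 - 2 * (u p.1 * u p.2) + u p.2 ^ 2 := by
    funext p; ring
  have i4 : Integrable (fun p : α × α => u p.1 ^ 2 - 2 * (u p.1 * u p.2)) (μ.prod ν) :=
    i1.sub (i3.const_mul 2)
  refine ⟨?_, by rw [e]; exact i4.add i2⟩
  have c1 : ∫ p, u p.1 ^ 2 ∂(μ.prod ν) = ν.real univ * ∫ x, u x ^ 2 ∂μ := by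
    simpa [mul_comm] using integral_prod_mul (μ := μ) (ν := ν) (fun x => u x ^ 2) fun _ => (1 : ℝ)
  -- The cross term factors and vanishes by the mean zero condition.
  have c3 : ∫ p, u p.1 * u p.2 ∂(μ.prod ν) = 0 := by
    rw [integral_prod_mul (μ := μ) (ν := ν) u u, h0, zero_mul]
  rw [e, integral_add i4 i2, integral_sub i1 (i3.const_mul 2), integral_const_mul, c1, c3]
  have : 0 ≤ ∫ p, u p.2 ^ 2 ∂(μ.prod ν) := integral_nonneg fun p => sq_nonneg _
  linarith

/-- The Poincaré inequality on star shaped domains, with the constant controlled by the volume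
ratio. -/
theorem l2Norm_le_of_isStarShapedWrt {Ω : Set (EuclideanSpace ℝ (Fin n))}
    {x₀ : EuclideanSpace ℝ (Fin n)} {r : ℝ} (hΩ : IsOpen Ω) (hb : Bornology.IsBounded Ω)
    (hr : 0 < r) (hstar : IsStarShapedWrt Ω (Metric.ball x₀ r))
    {u : EuclideanSpace ℝ (Fin n) → ℝ} (hu : MemH1 Ω u) (h0 : ∫ x in Ω, u x = 0) :
    l2Norm Ω u ≤ √(2 ^ n * (1 + volume.real Ω / volume.real (Metric.ball x₀ r))) *
      Metric.diam Ω * h1Seminorm Ω u := by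
  set B := Metric.ball x₀ r with hB
  have hfin : volume Ω < ⊤ := hb.measure_lt_top
  have hfinB : volume B < ⊤ := measure_ball_lt_top
  have hBpos : 0 < volume.real B := ENNReal.toReal_pos (Metric.measure_ball_pos _ _ hr).ne' hfinB.ne
  have : IsFiniteMeasure (volume.restrict Ω) := ⟨by simpa using hfin⟩
  have : IsFiniteMeasure (volume.restrict B) := ⟨by simpa using hfinB⟩
  have hg : ∀ i, IsWeakPartial Ω i u (weakPartial Ω i u) := fun i => by
    rw [weakPartial, dif_pos (hu.2 i)]
    exact (hu.2 i).choose_spec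
  have hgfin : ∀ i, ∫⁻ y in Ω, ‖weakPartial Ω i u y‖ₑ ^ 2 ≠ ⊤ := fun i => by
    have := (lintegral_rpow_enorm_lt_top_of_eLpNorm_lt_top (p := 2) (by norm_num) (by norm_num)
      (hg i).1.2).ne
    simpa using this
  obtain ⟨h1, hi⟩ := measureReal_mul_integral_sq_le hu.1
    (hu.1.mono_measure (Measure.restrict_mono hstar.1 le_rfl)) h0
  have h2 := lintegral_enorm_sub_sq_le_of_isWeakPartial hΩ hb hstar hu.1 hg
  have h3 : ∫ p, (u p.1 - u p.2) ^ 2 ∂((volume.restrict Ω).prod (volume.restrict B)) ≤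
      Metric.diam Ω ^ 2 * (2 ^ n * (volume.real Ω + volume.real B) * h1Seminorm Ω u ^ 2) := by
    rw [integral_eq_lintegral_of_nonneg_ae (Filter.Eventually.of_forall fun p => sq_nonneg _)
      hi.aestronglyMeasurable]
    have h4 : (fun p : EuclideanSpace ℝ (Fin n) × EuclideanSpace ℝ (Fin n) =>
        ENNReal.ofReal ((u p.1 - u p.2) ^ 2)) = fun p => ‖u p.1 - u p.2‖ₑ ^ 2 := by
      funext p
      rw [← ofReal_norm, ← ENNReal.ofReal_pow (norm_nonneg _), Real.norm_eq_abs, sq_abs]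
    rw [h4]
    refine (ENNReal.toReal_mono ?_ h2).trans_eq ?_
    · exact ENNReal.mul_ne_top ENNReal.ofReal_ne_top (ENNReal.mul_ne_top (ENNReal.mul_ne_top
        (by finiteness) (ENNReal.add_ne_top.2 ⟨hfin.ne, hfinB.ne⟩))
        (ENNReal.sum_ne_top.2 fun i _ => hgfin i))
    · rw [h1Seminorm, Real.sq_sqrt (Finset.sum_nonneg fun i _ => sq_nonneg _)]
      simp only [sq_l2Norm]
      rw [ENNReal.toReal_mul, ENNReal.toReal_mul, ENNReal.toReal_mul,
        ENNReal.toReal_add hfin.ne hfinB.ne, ENNReal.toReal_sum fun i _ => hgfin i,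
        ENNReal.toReal_ofReal (sq_nonneg _)]
      simp [Measure.real]
  have h5 : l2Norm Ω u ^ 2 = ∫ x in Ω, u x ^ 2 := by
    rw [sq_l2Norm, integral_eq_lintegral_of_nonneg_ae
      (Filter.Eventually.of_forall fun p => sq_nonneg _) hu.1.integrable_sq.aestronglyMeasurable]
    congr 2
    funext x
    rw [← ofReal_norm, ← ENNReal.ofReal_pow (norm_nonneg _), Real.norm_eq_abs, sq_abs]
  rw [measureReal_restrict_apply_univ, ← h5] at h1
  have hV : 0 ≤ volume.real Ω / volume.real B := by positivity
  have hh : 0 ≤ h1Seminorm Ω u := Real.sqrt_nonneg _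
  refine le_of_sq_le_sq ?_ (by positivity)
  rw [mul_pow, mul_pow, Real.sq_sqrt (by positivity)]
  refine le_of_mul_le_mul_left ((h1.trans h3).trans_eq ?_) hBpos
  field_simp
  ring

end StarShaped

/-! ### Comparison with the stated constant -/

/-- Split `1/2 = 1/(2(n-1)) + (n-2)/(2(n-1))`. The first power of `V` is at most `(2k)^(n/(2(n-1)))
≤ 2k`, as `n ≥ 2`. The logarithmic factor is at least `1` once `V ≥ e`; below that, `√V ≤ 2`
suffices. -/
theorem sqrt_le_two_mul_mul_one_add_log_rpow {n : ℕ} (hn : 2 ≤ n) {k V : ℝ} (hk : 1 ≤ k)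
    (hV : 1 ≤ V) (hVk : V ≤ (2 * k) ^ n) :
    √V ≤ 2 * k * (1 + Real.log V ^ ((n : ℝ) / (2 * ((n : ℝ) - 1))) *
      V ^ (((n : ℝ) - 2) / (2 * ((n : ℝ) - 1)))) := by
  have hn' : (2 : ℝ) ≤ n := by exact_mod_cast hn
  have hn1 : (0 : ℝ) < 2 * ((n : ℝ) - 1) := by linarith
  have hlog : 0 ≤ Real.log V := Real.log_nonneg hV
  have hpow : 0 ≤ V ^ (((n : ℝ) - 2) / (2 * ((n : ℝ) - 1))) := by positivity
  rcases le_total V (Real.exp 1) with h | h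
  · calc √V ≤ 2 := by
          rw [Real.sqrt_le_left two_pos.le]
          linarith [Real.exp_one_lt_d9]
      _ ≤ 2 * k * (1 + 0) := by linarith
      _ ≤ _ := by gcongr; positivity
  · have hl1 : 1 ≤ Real.log V := by
      rwa [Real.le_log_iff_exp_le (by linarith)]
    calc √V = V ^ (1 / (2 * ((n : ℝ) - 1))) * V ^ (((n : ℝ) - 2) / (2 * ((n : ℝ) - 1))) := by
          rw [Real.sqrt_eq_rpow, ← Real.rpow_add (by linarith)]
          have hne : (n : ℝ) - 1 ≠ 0 := by linarith
          congr 1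
          field_simp
          ring
      _ ≤ (2 * k) * V ^ (((n : ℝ) - 2) / (2 * ((n : ℝ) - 1))) := by
          gcongr
          calc V ^ (1 / (2 * ((n : ℝ) - 1))) ≤ ((2 * k) ^ n) ^ (1 / (2 * ((n : ℝ) - 1))) := by
                gcongr
            _ = (2 * k) ^ ((n : ℝ) / (2 * ((n : ℝ) - 1))) := by
                rw [← Real.rpow_natCast, ← Real.rpow_mul (by linarith), mul_one_div]
            _ ≤ (2 * k) ^ (1 : ℝ) := by
                refine Real.rpow_le_rpow_of_exponent_le (by linarith) ?_
                rw [div_le_one hn1]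
                linarith
            _ = 2 * k := Real.rpow_one _
      _ ≤ _ := by
          gcongr
          have h1 : 1 ≤ Real.log V ^ ((n : ℝ) / (2 * ((n : ℝ) - 1))) :=
            Real.one_le_rpow hl1 (by positivity)
          nlinarith

theorem mainTheorem6 (n : ℕ) (hn : 2 ≤ n) :
    ∃ C : ℝ, 0 < C ∧
      ∀ (Ω : Set (EuclideanSpace ℝ (Fin n))) (x₀ : EuclideanSpace ℝ (Fin n)) (r : ℝ),
        IsOpen Ω → Bornology.IsBounded Ω → 0 < r → IsStarShapedWrt Ω (Metric.ball x₀ r) →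
        ∃ K : ℝ, 0 ≤ K ∧
          (∀ u : EuclideanSpace ℝ (Fin n) → ℝ, MemH1 Ω u → ∫ x in Ω, u x = 0 →
            l2Norm Ω u ≤ K * Metric.diam Ω * h1Seminorm Ω u) ∧
          K ≤ C * (Metric.diam Ω / Metric.diam (Metric.ball x₀ r)) *
            (1 + Real.log (volume.real Ω / volume.real (Metric.ball x₀ r)) ^
                  ((n : ℝ) / (2 * ((n : ℝ) - 1))) *
                (volume.real Ω / volume.real (Metric.ball x₀ r)) ^
                  (((n : ℝ) - 2) / (2 * ((n : ℝ) - 1)))) := by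
  -- The root comes from `1 + V ≤ 2V`, the factor `2` from `√V ≤ 2k (1 + ⋯)`.
  refine ⟨2 * √(2 ^ (n + 1)), by positivity, fun Ω x₀ r hΩ hb hr hstar =>
    ⟨√(2 ^ n * (1 + volume.real Ω / volume.real (Metric.ball x₀ r))), Real.sqrt_nonneg _,
      fun u hu h0 => l2Norm_le_of_isStarShapedWrt hΩ hb hr hstar hu h0, ?_⟩⟩
  -- The diameter of a ball is twice its radius only in positive dimension.
  have : Nontrivial (Fin n) := Fin.nontrivial_iff_two_le.2 hn
  have hdiam : Metric.diam (Metric.ball x₀ r) = 2 * r := Metric.diam_ball_eq x₀ hr.le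
  have hBpos : 0 < volume.real (Metric.ball x₀ r) :=
    ENNReal.toReal_pos (Metric.measure_ball_pos _ _ hr).ne' measure_ball_lt_top.ne
  have hV1 : 1 ≤ volume.real Ω / volume.real (Metric.ball x₀ r) := by
    rw [one_le_div hBpos]
    exact measureReal_mono hstar.1 hb.measure_lt_top.ne
  have hk1 : 1 ≤ Metric.diam Ω / Metric.diam (Metric.ball x₀ r) := by
    rw [one_le_div (by rw [hdiam]; positivity)]
    exact Metric.diam_mono hstar.1 hb
  have hVk : volume.real Ω / volume.real (Metric.ball x₀ r) ≤
      (2 * (Metric.diam Ω / Metric.diam (Metric.ball x₀ r))) ^ n := by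
    -- The center `x₀` belongs to `Ω`. Since `ρ = 2r`, the ratio of the radii `R` and `r` is `2k`.
    have hsub : Ω ⊆ Metric.closedBall x₀ (Metric.diam Ω) := fun x hx =>
      Metric.dist_le_diam_of_mem hb hx (hstar.1 (Metric.mem_ball_self hr))
    have h1 : volume.real Ω ≤ volume.real (Metric.closedBall x₀ (Metric.diam Ω)) :=
      measureReal_mono hsub measure_closedBall_lt_top.ne
    have hunit : 0 < volume.real (Metric.ball (0 : EuclideanSpace ℝ (Fin n)) 1) :=
      ENNReal.toReal_pos (Metric.measure_ball_pos _ _ one_pos).ne' measure_ball_lt_top.ne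
    have h2 : volume.real (Metric.ball x₀ r) =
        r ^ n * volume.real (Metric.ball (0 : EuclideanSpace ℝ (Fin n)) 1) := by
      simp only [Measure.real]
      rw [Measure.addHaar_ball volume x₀ hr.le, ENNReal.toReal_mul, finrank_euclideanSpace_fin,
        ENNReal.toReal_ofReal (by positivity)]
    have h3 : volume.real (Metric.closedBall x₀ (Metric.diam Ω)) =
        Metric.diam Ω ^ n * volume.real (Metric.ball (0 : EuclideanSpace ℝ (Fin n)) 1) := by
      have := Metric.diam_nonneg (s := Ω)
      simp only [Measure.real]
      rw [Measure.addHaar_closedBall volume x₀ this, ENNReal.toReal_mul,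
        finrank_euclideanSpace_fin, ENNReal.toReal_ofReal (by positivity)]
    rw [div_le_iff₀ hBpos, h2, hdiam]
    refine (h1.trans_eq h3).trans_eq ?_
    rw [← mul_assoc, ← mul_pow]
    congr 2
    field_simp
  calc √(2 ^ n * (1 + volume.real Ω / volume.real (Metric.ball x₀ r)))
      ≤ √(2 ^ (n + 1) * (volume.real Ω / volume.real (Metric.ball x₀ r))) := by
        apply Real.sqrt_le_sqrt
        rw [pow_succ, mul_assoc]
        gcongr
        linarith
    _ = √(2 ^ (n + 1)) * √(volume.real Ω / volume.real (Metric.ball x₀ r)) :=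
        Real.sqrt_mul (by positivity) _
    _ ≤ _ := by
        rw [mul_comm 2 √(2 ^ (n + 1)), mul_assoc √(2 ^ (n + 1)), mul_assoc √(2 ^ (n + 1))]
        exact mul_le_mul_of_nonneg_left (sqrt_le_two_mul_mul_one_add_log_rpow hn hk1 hV1 hVk)
          (Real.sqrt_nonneg _)
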